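/- For $k\in\{12,16,18,20,22,26\}$ there is exactly one cusp form $\Delta_k=\sum_{n\ge 1}a_n(\Delta_k)q^n$ of weight $k$ for $\mathrm{SL}_2(\mathbb{Z})$ with $a_1(\Delta_k)=1$, where $q=e^{2\pi i z}$. Let $\theta=q\,\frac{d}{dq}$, so that $\theta\left(\sum_n b_nq^n\right)=\sum_n n\,b_nq^n$. For each $$(k,\ell,i,k')\in\{(16,13,2,12),\ (20,17,2,16),\ (22,11,0,12),\ (22,19,2,18),\ (26,13,1,12),\ (26,23,2,22)\},$$ the $q$-expansions of $\Delta_k$ and $\Delta_{k'}$ have integer coefficients and $$\Delta_k\equiv\theta^i\Delta_{k'} \pmod{\ell},$$ that is, $a_n(\Delta_k)\equiv n^i\,a_n(\Delta_{k'})\pmod{\ell}$ for all $n\ge 1$ (with $\theta^0$ the identity). -/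

import Mathlib

open scoped MatrixGroups PowerSeries

/-- The cusp form `f` of weight `k` for `SL₂(ℤ)` is normalized: in its `q`-expansion
`∑ aₙ qⁿ`, `q = exp (2πiz)`, one has `a₁ = 1`. -/
def IsNormalizedCuspForm {k : ℤ} (f : CuspForm 𝒮ℒ k) : Prop :=
  (UpperHalfPlane.qExpansion 1 f).coeff 1 = 1

/-- The operator `θ = q d/dq` on formal power series in `q`. -/
noncomputable def qTheta {R : Type*} [CommRing R] (F : R⟦X⟧) : R⟦X⟧ :=
  PowerSeries.X * PowerSeries.derivative R F

/-- The power series `F` with integer coefficients is the `q`-expansion of the cusp form `f`. -/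
def IsIntegralQExpansion {k : ℤ} (f : CuspForm 𝒮ℒ k) (F : ℤ⟦X⟧) : Prop :=
  PowerSeries.map (Int.castRingHom ℂ) F = UpperHalfPlane.qExpansion 1 f

/-- The congruence `f ≡ θⁱ g mod ℓ`: the `q`-expansions of `f` and `g` have integer coefficients,
and their reductions `f̃`, `g̃` modulo `ℓ` satisfy `f̃ = θⁱ g̃`. -/
def CongrTheta (ℓ i : ℕ) {k k' : ℤ} (f : CuspForm 𝒮ℒ k) (g : CuspForm 𝒮ℒ k') : Prop :=
  ∃ F G : ℤ⟦X⟧, IsIntegralQExpansion f F ∧ IsIntegralQExpansion g G ∧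
    PowerSeries.map (Int.castRingHom (ZMod ℓ)) F =
      qTheta^[i] (PowerSeries.map (Int.castRingHom (ZMod ℓ)) G)

/-! Write P, Q, R for the integral expansions of E₂, E₄, E₆ and Δ for the discriminant. In these
weights the cusp forms are Δ·M_{k-12} with M_{k-12} one-dimensional, so Δ_k is Δ times 1, Q, R, Q²,
QR or Q²R, with integer coefficients (`cuspForm_level_one`, `exists_discriminantInt`).

The four cases with i = 2 have ℓ = k'+1 and k = k'+4. For f of weight k' with Serre derivative ∂f,
Ramanujan's equations give θ²f = k'(k'+1)/144·P²f + (k'+1)/6·P∂f + (∂²f − k'Qf/144). Modulo ℓ the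
terms in P vanish, leaving a cusp form of weight k'+4, a multiple of Δ_k; comparing a₁ gives the
factor 1. Explicitly, c(Δ_k − θ²Δ_{k'}) is ℓ times an integral series with c prime to ℓ (the lemmas
of `IsRamanujanSystem`, `map_zmod_eq_of_mul_sub_eq`).

The other two cases are Eisenstein congruences: QR = E₁₀ ≡ 1 mod 11, and Q²R = E₁₄ ≡ P mod 13 with
θΔ = PΔ. -/

/-! ### Differentiating q-expansions, and the quasimodularity of E₂. -/

section QExpansionDerivative

open UpperHalfPlane Derivative EisensteinSeries
open scoped Manifold ModularForm ArithmeticFunction.sigma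

/-- A function on the upper half plane that is holomorphic, invariant under `z ↦ z + 1` and
bounded at `i∞`; equivalently, it is given by a convergent `q`-expansion. -/
structure IsHolomorphicAtCusp (F : ℍ → ℂ) : Prop where
  holo : MDiff F
  periodic : Function.Periodic (F ∘ ofComplex) ((1 : ℝ) : ℂ)
  bdd : IsBoundedAtImInfty F

lemma periodic_comp_ofComplex_of_hasSum {F : ℍ → ℂ} {c : ℕ → ℂ}
    (hF : ∀ τ : ℍ, HasSum (fun m ↦ c m • Function.Periodic.qParam 1 τ ^ m) (F τ)) :
    Function.Periodic (F ∘ ofComplex) ((1 : ℝ) : ℂ) := by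
  intro w
  by_cases! hw : 0 < w.im
  · have hw' : 0 < (w + ((1 : ℝ) : ℂ)).im := by simpa using hw
    simp only [Function.comp_apply, ofComplex_apply_of_im_pos hw', ofComplex_apply_of_im_pos hw]
    refine (hF _).unique ?_
    have hq : Function.Periodic.qParam 1 (w + ((1 : ℝ) : ℂ)) = Function.Periodic.qParam 1 w :=
      by simp [Function.Periodic.qParam, mul_add, Complex.exp_add]
    simpa only [hq] using! hF ⟨w, hw⟩
  -- Off the upper half plane `ofComplex` takes a constant default value, so periodicity holds there
  -- too.
  · have hw' : (w + ((1 : ℝ) : ℂ)).im ≤ 0 := by simpa using hw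
    simp only [Function.comp_apply, ofComplex_apply_of_im_nonpos hw',
      ofComplex_apply_of_im_nonpos hw]

namespace IsHolomorphicAtCusp

lemma of_hasSum {F : ℍ → ℂ} (holo : MDiff F) {c : ℕ → ℂ}
    (hF : ∀ τ : ℍ, HasSum (fun m ↦ c m • Function.Periodic.qParam 1 τ ^ m) (F τ)) :
    IsHolomorphicAtCusp F :=
  ⟨holo, periodic_comp_ofComplex_of_hasSum hF, isBoundedAtImInfty_of_hasSum_qExpansion one_pos hF⟩

lemma of_modularForm {k : ℤ} (f : ModularForm 𝒮ℒ k) : IsHolomorphicAtCusp f :=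
  ⟨f.holo', SlashInvariantFormClass.periodic_comp_ofComplex f one_mem_strictPeriods_SL,
    ModularFormClass.bdd_at_infty f⟩

variable {F G : ℍ → ℂ}

lemma analyticAt_cuspFunction (hF : IsHolomorphicAtCusp F) :
    AnalyticAt ℂ (cuspFunction 1 F) 0 :=
  analyticAt_cuspFunction_zero one_pos hF.periodic hF.holo hF.bdd

/-- The given series and the Taylor series both represent the cusp function at q = 0, where power
series are unique. -/
lemma qExpansion_coeff_eq_of_hasSum (hF : IsHolomorphicAtCusp F) {c : ℕ → ℂ}
    (h : ∀ τ : ℍ, HasSum (fun m ↦ c m • Function.Periodic.qParam 1 τ ^ m) (F τ)) (m : ℕ) :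
    (qExpansion 1 F).coeff m = c m := by
  have h1 := (hasFPowerSeriesOnBall_cuspFunction one_pos hF.analyticAt_cuspFunction
    h).hasFPowerSeriesAt
  have h2 := hF.analyticAt_cuspFunction.hasFPowerSeriesAt
  simpa [qExpansion_coeff, div_eq_mul_inv, mul_comm] using
    (congr_arg (FormalMultilinearSeries.coeff · m) (h1.eq_formalMultilinearSeries h2)).symm

lemma sub (hF : IsHolomorphicAtCusp F) (hG : IsHolomorphicAtCusp G) :
    IsHolomorphicAtCusp (F - G) where
  holo := hF.holo.sub hG.holo
  periodic := hF.periodic.sub hG.periodic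
  bdd := hF.bdd.sub hG.bdd

lemma mul (hF : IsHolomorphicAtCusp F) (hG : IsHolomorphicAtCusp G) :
    IsHolomorphicAtCusp (F * G) where
  holo := hF.holo.mul hG.holo
  periodic := hF.periodic.mul hG.periodic
  bdd := by simpa [IsBoundedAtImInfty] using! hF.bdd.mul hG.bdd

lemma smul (c : ℂ) (hF : IsHolomorphicAtCusp F) : IsHolomorphicAtCusp (c • F) where
  holo := hF.holo.const_smul c
  periodic := hF.periodic.smul c
  bdd := hF.bdd.const_smul_left c

/-- The `q`-expansion of `D F` is obtained by multiplying the `n`-th coefficient by `n`. -/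
lemma hasSum_normalizedDeriv (hF : IsHolomorphicAtCusp F) (τ : ℍ) :
    HasSum (fun m ↦ (qTheta (qExpansion 1 F)).coeff m • Function.Periodic.qParam 1 τ ^ m)
      (normalizedDerivOfComplex F τ) := by
  set q := Function.Periodic.qParam 1 (τ : ℂ) with hq
  have hq1 : ‖q‖ < 1 := Function.Periodic.norm_qParam_lt_one one_pos τ.im_pos
  have hqball : q ∈ Metric.ball (0 : ℂ) 1 := by simpa using hq1
  set g := cuspFunction 1 F with hg
  have hgdiff : DifferentiableOn ℂ g (Metric.ball 0 1) :=
    differentiableOn_cuspFunction_ball one_pos hF.periodic hF.holo hF.bdd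
  -- Chain rule: F = g ∘ q with dq/dτ = 2πi·q, and the normalization divides by 2πi.
  have hD : normalizedDerivOfComplex F τ = q * deriv g q := by
    have hcomp : F ∘ ofComplex = g ∘ Function.Periodic.qParam 1 := by
      ext z
      exact (Function.Periodic.eq_cuspFunction one_ne_zero hF.periodic z).symm
    have hqd : HasDerivAt (Function.Periodic.qParam 1) (q * (2 * Real.pi * Complex.I)) (τ : ℂ) := by
      have h1 : HasDerivAt (fun z : ℂ ↦ 2 * Real.pi * Complex.I * z / ((1 : ℝ) : ℂ))
          (2 * Real.pi * Complex.I) (τ : ℂ) := by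
        simpa using (hasDerivAt_id (τ : ℂ)).const_mul (2 * Real.pi * Complex.I)
      exact h1.cexp
    have hgd : HasDerivAt g (deriv g q) (Function.Periodic.qParam 1 (τ : ℂ)) :=
      (hgdiff.differentiableAt (Metric.isOpen_ball.mem_nhds hqball)).hasDerivAt
    rw [normalizedDerivOfComplex, hcomp, (hgd.comp (τ : ℂ) hqd).deriv]
    field_simp [Complex.two_pi_I_ne_zero]
  have hsum := Complex.hasSum_taylorSeries_on_ball
    (hgdiff.deriv Metric.isOpen_ball) hqball
  -- The constant term of the θ-series is 0; dropping it leaves q times the Taylor series of g'.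
  rw [hD, ← hasSum_nat_add_iff' 1]
  simp only [Finset.range_one, Finset.sum_singleton, qTheta, PowerSeries.coeff_zero_X_mul,
    zero_smul, sub_zero]
  convert! hsum.mul_left q using 2 with n
  rw [PowerSeries.coeff_succ_X_mul, PowerSeries.coeff_derivative, qExpansion_coeff,
    iteratedDeriv_succ', Nat.factorial_succ]
  have : (n.factorial : ℂ) ≠ 0 := by exact_mod_cast n.factorial_ne_zero
  have : (n + 1 : ℂ) ≠ 0 := by exact_mod_cast n.succ_ne_zero
  simp only [smul_eq_mul, sub_zero]
  push_cast
  field_simp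
  rw [hg]
  ring

lemma normalizedDeriv (hF : IsHolomorphicAtCusp F) :
    IsHolomorphicAtCusp (normalizedDerivOfComplex F) :=
  of_hasSum (normalizedDerivOfComplex_mdifferentiable hF.holo) hF.hasSum_normalizedDeriv

lemma qExpansion_normalizedDeriv (hF : IsHolomorphicAtCusp F) :
    qExpansion 1 (normalizedDerivOfComplex F) = qTheta (qExpansion 1 F) :=
  PowerSeries.ext (hF.normalizedDeriv.qExpansion_coeff_eq_of_hasSum hF.hasSum_normalizedDeriv)

/-- A holomorphic function with a `q`-expansion that is invariant under the weight `k` action of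
`SL₂(ℤ)` is a modular form. -/
def toModularForm {k : ℤ} (hF : IsHolomorphicAtCusp F) (hinv : ∀ γ : SL(2, ℤ), F ∣[k] γ = F) :
    ModularForm 𝒮ℒ k where
  toFun := F
  slash_action_eq' := fun _ ⟨γ, hγ⟩ ↦ hγ ▸ hinv γ
  holo' := hF.holo
  bdd_at_cusps' {c} hc := by
    rw [Subgroup.IsArithmetic.isCusp_iff_isCusp_SL2Z] at hc
    rw [OnePoint.isBoundedAt_iff_forall_SL2Z hc]
    -- Every cusp is a translate of ∞, and invariance reduces boundedness there to `hF.bdd`.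
    intro γ _
    rw [hinv γ]
    exact hF.bdd

@[simp]
lemma coe_toModularForm {k : ℤ} (hF : IsHolomorphicAtCusp F)
    (hinv : ∀ γ : SL(2, ℤ), F ∣[k] γ = F) : ⇑(hF.toModularForm hinv) = F := rfl

end IsHolomorphicAtCusp

lemma hasSum_qParam_E2 (τ : ℍ) :
    HasSum (fun m ↦ (if m = 0 then 1 else -24 * σ 1 m : ℂ) • Function.Periodic.qParam 1 τ ^ m)
      (E2 τ) := by
  simpa only [Function.Periodic.qParam, Complex.ofReal_one, div_one] using hasSum_qExpansion_E2 τ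

lemma isHolomorphicAtCusp_E2 : IsHolomorphicAtCusp E2 :=
  .of_hasSum E2_mdifferentiable hasSum_qParam_E2

lemma qExpansion_E2_coeff (m : ℕ) :
    (qExpansion 1 E2).coeff m = if m = 0 then 1 else -24 * (σ 1 m : ℂ) :=
  isHolomorphicAtCusp_E2.qExpansion_coeff_eq_of_hasSum hasSum_qParam_E2 m

/-- The derivative of the cocycle `γ ↦ c / (cz + d)`. -/
lemma normalizedDerivOfComplex_inv_denom (γ : SL(2, ℤ)) (z : ℍ) :
    normalizedDerivOfComplex (fun w : ℍ ↦ (γ 1 0 : ℂ) / denom γ w) z =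
      -(2 * Real.pi * Complex.I)⁻¹ * ((γ 1 0 : ℂ) / denom γ z) ^ 2 := by
  have hcomp : ((fun w : ℍ ↦ (γ 1 0 : ℂ) / denom γ w) ∘ ofComplex) =ᶠ[nhds (z : ℂ)]
      fun w ↦ (γ 1 0 : ℂ) * denom γ w ^ (-1 : ℤ) := by
    filter_upwards [isOpen_upperHalfPlaneSet.mem_nhds z.im_pos] with w hw
    simp [ofComplex_apply_of_im_pos hw, div_eq_mul_inv]
  have hd := ((hasDerivAt_denom_zpow (γ : GL (Fin 2) ℝ) (-1) z).const_mul (γ 1 0 : ℂ))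
  rw [normalizedDerivOfComplex, (hd.congr_of_eventuallyEq hcomp).deriv]
  have hz := denom_ne_zero (γ : GL (Fin 2) ℝ) z
  have : (denom γ z : ℂ) ^ (-1 - 1 : ℤ) = (denom γ z ^ 2)⁻¹ := by
    rw [← zpow_natCast, ← zpow_neg]; norm_num
  rw [this]
  simp
  field_simp

lemma mdifferentiable_div_denom (γ : SL(2, ℤ)) :
    MDiff (fun w : ℍ ↦ (γ 1 0 : ℂ) / denom γ w) := by
  simp only [div_eq_mul_inv]
  exact mdifferentiable_const.mul (mdifferentiable_inv_denom (γ : GL (Fin 2) ℝ))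

/-- `D E₂ - E₂² / 12` is invariant under the weight `4` action of `SL₂(ℤ)`. -/
lemma normalizedDeriv_E2_sub_slash (γ : SL(2, ℤ)) :
    (normalizedDerivOfComplex E2 - (12⁻¹ : ℂ) • (E2 * E2)) ∣[(4 : ℤ)] γ =
      normalizedDerivOfComplex E2 - (12⁻¹ : ℂ) • (E2 * E2) := by
  set u : ℍ → ℂ := fun w ↦ (γ 1 0 : ℂ) / denom γ w with hu
  have hpi : (Real.pi : ℂ) ≠ 0 := by exact_mod_cast Real.pi_ne_zero
  -- With w = (2πi)⁻¹ the anomaly is E₂ + 12wu, and Du = −wu². Both D E₂ and E₂²/12 then acquire the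
  -- same extra terms 2wuE₂ + 12w²u², which cancel.
  have hE : E2 ∣[(2 : ℤ)] γ = E2 - (6 * Complex.I / Real.pi) • u := by
    rw [E2_slash_action]
    congr 1
    ext z
    simp only [Pi.smul_apply, smul_eq_mul, D2, riemannZeta_two, hu]
    field_simp
  have hD := normalizedDerivOfComplex_SL_slash (k := 2) E2_mdifferentiable (γ := γ)
  have hmu : MDiff u := mdifferentiable_div_denom γ
  rw [hE, normalizedDerivOfComplex_sub _ _ E2_mdifferentiable (hmu.const_smul _),
    normalizedDerivOfComplex_smul _ _ hmu] at hD
  have hmul : (E2 * E2) ∣[(4 : ℤ)] γ = (E2 ∣[(2 : ℤ)] γ) * (E2 ∣[(2 : ℤ)] γ) :=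
    ModularForm.mul_slash_SL2 2 2 γ E2 E2
  ext z
  have hz := congrFun hD z
  have hDu := normalizedDerivOfComplex_inv_denom γ z
  rw [sub_eq_add_neg, SlashAction.add_slash, SlashAction.neg_slash, ModularForm.SL_smul_slash,
    hmul, hE]
  change _ = (normalizedDerivOfComplex E2 ∣[(4 : ℤ)] γ) z - _ at hz
  simp only [Pi.sub_apply, Pi.smul_apply, smul_eq_mul, Pi.add_apply, Pi.neg_apply,
    Pi.mul_apply] at hz ⊢
  have e1 : normalizedDerivOfComplex u z = -(2 * Real.pi * Complex.I)⁻¹ * u z ^ 2 := hDu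
  have e2 : (γ 1 0 : ℂ) / denom γ z = u z := rfl
  simp only [e1, e2] at hz
  have hinv : (2 * Real.pi * Complex.I)⁻¹ = -Complex.I * (Real.pi : ℂ)⁻¹ / 2 := by
    rw [mul_inv, mul_inv, Complex.inv_I]
    ring
  rw [hinv] at hz
  push_cast at hz
  linear_combination -hz

end QExpansionDerivative

/-! ### Level one forms in small weight, Ramanujan's identities, normalized cusp forms. -/

section LevelOne

open UpperHalfPlane ModularForm Derivative EisensteinSeries
open scoped Manifold ModularForm ArithmeticFunction.sigma

/-- In weight less than `12` or equal to `14`, a level one modular form is determined by the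
constant term of its `q`-expansion. -/
lemma ModularForm.eq_zero_of_coeff_zero {k : ℤ} (hk : k < 12 ∨ k = 14) (f : ModularForm 𝒮ℒ k)
    (hf : (qExpansion 1 f).coeff 0 = 0) : f = 0 := by
  rcases hk with hk | rfl
  · refine sturm_bound_levelOne ?_
    have : k.toNat / 12 = 0 := by lia
    rw [this, Nat.cast_zero]
    refine pos_iff_ne_zero.mpr fun h ↦ ?_
    exact ((PowerSeries.order_eq_nat (n := 0)).mp (mod_cast h)).1 hf
  -- In weight 14 the Sturm bound is 1, so one coefficient is not enough; instead f is Δ times a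
  -- form of weight 2, hence zero.
  · suffices CuspForm.discriminantEquiv (toCuspForm f hf) = 0 by
      simpa [CuspForm.discriminantEquiv.map_eq_zero_iff, DFunLike.ext_iff] using this
    exact rank_zero_iff_forall_zero.mp levelOne_weight_two_rank_zero
      (CuspForm.discriminantEquiv (toCuspForm f hf))

lemma ModularForm.eq_of_coeff_zero_eq {k : ℤ} (hk : k < 12 ∨ k = 14) {f g : ModularForm 𝒮ℒ k}
    (h : (qExpansion 1 f).coeff 0 = (qExpansion 1 g).coeff 0) : f = g := by
  rw [← sub_eq_zero]
  refine eq_zero_of_coeff_zero hk _ ?_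
  rw [FunLike.coe_sub, ModularForm.qExpansion_sub one_pos one_mem_strictPeriods_SL, map_sub, h,
    sub_self]

lemma ModularForm.qExpansion_eq_of_coeff_zero_eq {k : ℤ} (hk : k < 12 ∨ k = 14)
    (f g : ModularForm 𝒮ℒ k)
    (h : (qExpansion 1 f).coeff 0 = (qExpansion 1 g).coeff 0) :
    qExpansion 1 f = qExpansion 1 g := by
  rw [eq_of_coeff_zero_eq hk h]

lemma qTheta_coeff_zero {R : Type*} [CommRing R] (F : R⟦X⟧) : (qTheta F).coeff 0 = 0 := by
  simp [qTheta]

/-- A Ramanujan-type identity: the Serre derivative of a normalized level one form of weight `k < 10`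
is `-k / 12` times any normalized form of weight `k + 2`. -/
lemma qTheta_qExpansion_eq {k l : ℤ} (hl : k + 2 = l) (hk : l < 12) (f : ModularForm 𝒮ℒ k)
    (g : ModularForm 𝒮ℒ l) (hf : (qExpansion 1 f).coeff 0 = 1)
    (hg : (qExpansion 1 g).coeff 0 = 1) :
    qTheta (qExpansion 1 f) =
      (k / 12 : ℂ) • (qExpansion 1 E2 * qExpansion 1 f - qExpansion 1 g) := by
  subst hl
  have hfc := IsHolomorphicAtCusp.of_modularForm f
  have hE := isHolomorphicAtCusp_E2
  have hS : serreDerivative k f =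
      normalizedDerivOfComplex f - (k / 12 : ℂ) • (E2 * (f : ℍ → ℂ)) := by
    ext z
    simp only [serreDerivative_apply, Pi.sub_apply, Pi.smul_apply, Pi.mul_apply, smul_eq_mul]
    ring
  have hSc : IsHolomorphicAtCusp (serreDerivative k f) :=
    hS ▸ hfc.normalizedDeriv.sub ((hE.mul hfc).smul _)
  let F : ModularForm 𝒮ℒ (k + 2) := hSc.toModularForm fun γ ↦
    serreDerivative_slash_invariant f.holo' (f.slash_action_eq' _ ⟨γ, rfl⟩)
  have hF : qExpansion 1 F =
      qTheta (qExpansion 1 f) - (k / 12 : ℂ) • (qExpansion 1 E2 * qExpansion 1 f) := by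
    rw [IsHolomorphicAtCusp.coe_toModularForm, hS,
      qExpansion_sub hfc.normalizedDeriv.analyticAt_cuspFunction
        ((hE.mul hfc).smul _).analyticAt_cuspFunction,
      qExpansion_smul (hE.mul hfc).analyticAt_cuspFunction,
      qExpansion_mul hE.analyticAt_cuspFunction hfc.analyticAt_cuspFunction,
      hfc.qExpansion_normalizedDeriv]
  have key := qExpansion_eq_of_coeff_zero_eq (.inl hk) F ((-(k / 12) : ℂ) • g) <| by
    rw [hF, FunLike.coe_smul, ModularForm.qExpansion_smul one_pos one_mem_strictPeriods_SL, map_sub,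
      qTheta_coeff_zero, PowerSeries.coeff_smul, PowerSeries.coeff_smul, hg, PowerSeries.coeff_mul]
    simp [-PowerSeries.coeff_zero_eq_constantCoeff, hf, qExpansion_E2_coeff]
  rw [hF, FunLike.coe_smul, ModularForm.qExpansion_smul one_pos one_mem_strictPeriods_SL] at key
  rw [eq_add_of_sub_eq key]
  module

lemma E_four_coeff_zero : (qExpansion 1 E₄).coeff 0 = 1 := E_qExpansion_coeff_zero _ ⟨2, rfl⟩

lemma E_six_coeff_zero : (qExpansion 1 E₆).coeff 0 = 1 := E_qExpansion_coeff_zero _ ⟨3, rfl⟩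

lemma coeff_zero_mul_eq_one {p q : ℂ⟦X⟧} (hp : p.coeff 0 = 1) (hq : q.coeff 0 = 1) :
    (p * q).coeff 0 = 1 := by
  simp_all

/-- Ramanujan's identity for the derivative of `E₂`. -/
lemma qTheta_E_two : 12 * qTheta (qExpansion 1 E2) = qExpansion 1 E2 ^ 2 - qExpansion 1 E₄ := by
  have hE := isHolomorphicAtCusp_E2
  have hc : IsHolomorphicAtCusp (normalizedDerivOfComplex E2 - (12⁻¹ : ℂ) • (E2 * E2)) :=
    hE.normalizedDeriv.sub ((hE.mul hE).smul _)
  let F : ModularForm 𝒮ℒ 4 := hc.toModularForm normalizedDeriv_E2_sub_slash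
  have hF : qExpansion 1 F =
      qTheta (qExpansion 1 E2) - (12⁻¹ : ℂ) • (qExpansion 1 E2 * qExpansion 1 E2) := by
    rw [IsHolomorphicAtCusp.coe_toModularForm,
      qExpansion_sub hE.normalizedDeriv.analyticAt_cuspFunction
        ((hE.mul hE).smul _).analyticAt_cuspFunction,
      qExpansion_smul (hE.mul hE).analyticAt_cuspFunction,
      qExpansion_mul hE.analyticAt_cuspFunction hE.analyticAt_cuspFunction,
      hE.qExpansion_normalizedDeriv]
  have key := qExpansion_eq_of_coeff_zero_eq (.inl (by norm_num)) F ((-12⁻¹ : ℂ) • E₄) <| by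
    rw [hF, FunLike.coe_smul, ModularForm.qExpansion_smul one_pos one_mem_strictPeriods_SL, map_sub,
      qTheta_coeff_zero, PowerSeries.coeff_smul, PowerSeries.coeff_smul, E_four_coeff_zero,
      PowerSeries.coeff_mul]
    simp [-PowerSeries.coeff_zero_eq_constantCoeff, qExpansion_E2_coeff]
  rw [hF, FunLike.coe_smul, ModularForm.qExpansion_smul one_pos one_mem_strictPeriods_SL] at key
  have h12 : (12 : ℂ⟦X⟧) * PowerSeries.C (12⁻¹ : ℂ) = 1 := by
    rw [← map_ofNat (PowerSeries.C (R := ℂ)) 12, ← map_mul]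
    simp
  rw [PowerSeries.smul_eq_C_mul, PowerSeries.smul_eq_C_mul, map_neg] at key
  linear_combination 12 * key + (qExpansion 1 E2 ^ 2 - qExpansion 1 E₄) * h12

/-- Ramanujan's identity for the derivative of `E₄`. -/
lemma qTheta_E_four : 3 * qTheta (qExpansion 1 E₄) =
    qExpansion 1 E2 * qExpansion 1 E₄ - qExpansion 1 E₆ := by
  rw [qTheta_qExpansion_eq (l := 6) (by norm_num) (by norm_num) E₄ E₆ E_four_coeff_zero
    E_six_coeff_zero, PowerSeries.smul_eq_C_mul, ← mul_assoc,
    ← map_ofNat (PowerSeries.C (R := ℂ)) 3, ← map_mul]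
  norm_num

/-- Ramanujan's identity for the derivative of `E₆`. -/
lemma qTheta_E_six : 2 * qTheta (qExpansion 1 E₆) =
    qExpansion 1 E2 * qExpansion 1 E₆ - qExpansion 1 E₄ ^ 2 := by
  have h := ModularForm.qExpansion_mul one_pos one_mem_strictPeriods_SL E₄ E₄
  rw [qTheta_qExpansion_eq (l := 4 + 4) (by norm_num) (by norm_num) E₆ (E₄.mul E₄)
    E_six_coeff_zero (h ▸ coeff_zero_mul_eq_one E_four_coeff_zero E_four_coeff_zero), h,
    PowerSeries.smul_eq_C_mul, ← mul_assoc, ← map_ofNat (PowerSeries.C (R := ℂ)) 2, ← map_mul, sq]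
  norm_num

/-- As an Eisenstein series the product has explicit divisor-sum coefficients, from which the
congruence modulo 11 can be read off. -/
lemma qExpansion_E_ten : qExpansion 1 E₄ * qExpansion 1 E₆ =
    qExpansion 1 (E (k := 10) (by norm_num)) := by
  rw [← ModularForm.qExpansion_mul one_pos one_mem_strictPeriods_SL E₄ E₆]
  refine qExpansion_eq_of_coeff_zero_eq (k := 10) (.inl (by norm_num)) (E₄.mul E₆) _ ?_
  rw [E_qExpansion_coeff_zero _ ⟨5, rfl⟩,
    ModularForm.qExpansion_mul one_pos one_mem_strictPeriods_SL E₄ E₆]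
  exact coeff_zero_mul_eq_one E_four_coeff_zero E_six_coeff_zero

lemma qExpansion_E_fourteen : qExpansion 1 E₄ ^ 2 * qExpansion 1 E₆ =
    qExpansion 1 (E (k := 14) (by norm_num)) := by
  have h : qExpansion 1 ((E₄.mul E₄).mul E₆) = qExpansion 1 E₄ ^ 2 * qExpansion 1 E₆ := by
    rw [ModularForm.qExpansion_mul one_pos one_mem_strictPeriods_SL,
      ModularForm.qExpansion_mul one_pos one_mem_strictPeriods_SL, sq]
  rw [← h]
  refine qExpansion_eq_of_coeff_zero_eq (k := 14) (.inr rfl) ((E₄.mul E₄).mul E₆) _ ?_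
  rw [E_qExpansion_coeff_zero _ ⟨7, rfl⟩, h, sq]
  exact coeff_zero_mul_eq_one (coeff_zero_mul_eq_one E_four_coeff_zero E_four_coeff_zero)
    E_six_coeff_zero

lemma qExpansion_discriminant :
    1728 * qExpansion 1 discriminant = qExpansion 1 E₄ ^ 3 - qExpansion 1 E₆ ^ 2 := by
  have h : (1728 : ℂ) • discriminant = ⇑((E₄.mul E₄).mul E₄) - ⇑(E₆.mul E₆) := by
    ext z
    simp only [Pi.smul_apply, smul_eq_mul, discriminant_eq_E₄_cube_sub_E₆_sq, Pi.sub_apply,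
      coe_mul, Pi.mul_apply]
    ring
  have h' := congrArg (qExpansion 1) h
  rw [← CuspForm.coe_discriminant, ModularForm.qExpansion_smul one_pos one_mem_strictPeriods_SL,
    ModularForm.qExpansion_sub one_pos one_mem_strictPeriods_SL,
    ModularForm.qExpansion_mul one_pos one_mem_strictPeriods_SL,
    ModularForm.qExpansion_mul one_pos one_mem_strictPeriods_SL,
    ModularForm.qExpansion_mul one_pos one_mem_strictPeriods_SL, PowerSeries.smul_eq_C_mul,
    map_ofNat] at h'
  rw [← CuspForm.coe_discriminant, h']
  ring

/-- A cusp form of weight `k + 12` is the product of the discriminant with a form of weight `k`;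
if the latter is determined by its constant term, there is a unique normalized cusp form. -/
lemma existsUnique_isNormalizedCuspForm {k l : ℤ} (hl : k + 12 = l) (hk : k < 12 ∨ k = 14)
    (H : ModularForm 𝒮ℒ k) (hH : (qExpansion 1 H).coeff 0 = 1) :
    (∃! f : CuspForm 𝒮ℒ l, IsNormalizedCuspForm f) ∧
      ∀ f : CuspForm 𝒮ℒ l, IsNormalizedCuspForm f →
        qExpansion 1 f = qExpansion 1 discriminant * qExpansion 1 H := by
  obtain rfl : k = l - 12 := by lia
  have hq (f : CuspForm 𝒮ℒ l) : qExpansion 1 f =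
      qExpansion 1 discriminant * qExpansion 1 (CuspForm.discriminantEquiv f) := by
    rw [← discriminant_mul_discriminantEquiv f, ← CuspForm.coe_discriminant]
    exact ModularForm.qExpansion_mul_coe one_pos one_mem_strictPeriods_SL _ _
  have h0 : (qExpansion 1 discriminant).coeff 0 = 0 :=
    CuspFormClass.qExpansion_coeff_zero CuspForm.discriminant one_pos one_mem_strictPeriods_SL
  have h1 (f : CuspForm 𝒮ℒ l) : (qExpansion 1 f).coeff 1 =
      (qExpansion 1 (CuspForm.discriminantEquiv f)).coeff 0 := by
    rw [hq, PowerSeries.coeff_mul, Finset.Nat.antidiagonal_succ]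
    simp [-PowerSeries.coeff_zero_eq_constantCoeff, h0, discriminant_qExpansion_coeff_one]
  have hn (f : CuspForm 𝒮ℒ l) (hf : IsNormalizedCuspForm f) : CuspForm.discriminantEquiv f = H :=
    eq_of_coeff_zero_eq hk (by rw [← h1, hH]; exact hf)
  refine ⟨⟨CuspForm.discriminantEquiv.symm H, ?_, fun f hf ↦ ?_⟩, fun f hf ↦ ?_⟩
  · exact (h1 _).trans (by rw [LinearEquiv.apply_symm_apply, hH])
  · rw [← hn f hf, LinearEquiv.symm_apply_apply]
  · rw [hq, hn f hf]

end LevelOne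

/-! ### Formal consequences of Ramanujan's differential equations. -/

section Theta

variable {A B : Type*} [CommRing A] [CommRing B]

lemma qTheta_mul (F G : A⟦X⟧) : qTheta (F * G) = qTheta F * G + F * qTheta G := by
  simp only [qTheta, Derivation.leibniz, smul_eq_mul]
  ring

lemma qTheta_sub (F G : A⟦X⟧) : qTheta (F - G) = qTheta F - qTheta G := by
  simp only [qTheta, map_sub, mul_sub]

lemma qTheta_ofNat (n : ℕ) [n.AtLeastTwo] : qTheta (ofNat(n) : A⟦X⟧) = 0 := by
  rw [← Nat.cast_ofNat, qTheta, Derivation.map_natCast, mul_zero]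

lemma coeff_intCast_mul (c : ℤ) (F : A⟦X⟧) (n : ℕ) :
    PowerSeries.coeff n ((c : A⟦X⟧) * F) = c * PowerSeries.coeff n F := by
  rw [← map_intCast (PowerSeries.C (R := A)), PowerSeries.coeff_C_mul]

lemma powerSeries_ofNat_ne_zero [CharZero A] (n : ℕ) [n.AtLeastTwo] : (ofNat(n) : A⟦X⟧) ≠ 0 := by
  intro h
  have := congrArg PowerSeries.constantCoeff h
  rw [map_ofNat, map_zero] at this
  exact OfNat.ofNat_ne_zero n this

lemma map_qTheta (φ : A →+* B) (F : A⟦X⟧) :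
    PowerSeries.map φ (qTheta F) = qTheta (PowerSeries.map φ F) := by
  ext n
  cases n with
  | zero => simp [qTheta]
  | succ n =>
    simp [qTheta, PowerSeries.coeff_succ_X_mul, PowerSeries.coeff_derivative]

lemma map_qTheta_iterate (φ : A →+* B) (i : ℕ) (F : A⟦X⟧) :
    PowerSeries.map φ (qTheta^[i] F) = qTheta^[i] (PowerSeries.map φ F) :=
  Function.Semiconj.iterate_right (f := PowerSeries.map φ) (map_qTheta φ) i F

/-- Series `p, q, r, d` satisfying Ramanujan's differential equations, where `d` plays the role
of the discriminant. -/
structure IsRamanujanSystem (p q r d : A⟦X⟧) : Prop where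
  theta_p : 12 * qTheta p = p ^ 2 - q
  theta_q : 3 * qTheta q = p * q - r
  theta_r : 2 * qTheta r = p * r - q ^ 2
  theta_d : qTheta d = p * d

namespace IsRamanujanSystem

variable {p q r d : A⟦X⟧}

/-- Since θ²d = (θp + p²)d, one gets 12θ²d = (13p² − q)d; the 13 is 12 + 1. -/
lemma theta_theta_d (h : IsRamanujanSystem p q r d) :
    12 * (q * d - qTheta^[2] d) = 13 * ((q - p ^ 2) * d) := by
  simp only [Function.iterate_succ, Function.iterate_zero, Function.comp_apply, id]
  rw [h.theta_d, qTheta_mul, h.theta_d]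
  linear_combination -d * h.theta_p

lemma theta_theta_q_mul_d (h : IsRamanujanSystem p q r d) :
    18 * (q ^ 2 * d - qTheta^[2] (q * d)) = 17 * ((q ^ 2 + p * r - 2 * p ^ 2 * q) * d) := by
  have h1 : 3 * qTheta (q * d) = (4 * (p * q) - r) * d := by
    rw [qTheta_mul, h.theta_d]
    linear_combination d * h.theta_q
  -- Differentiating the denominator-free `h1` gives the second derivative in terms of θp, θq, θr,
  -- which the final combination eliminates.
  have h2 := congrArg qTheta h1
  simp only [qTheta_ofNat, qTheta_mul, qTheta_sub, h.theta_d] at h2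
  simp only [Function.iterate_succ, Function.iterate_zero, Function.comp_apply, id, qTheta_mul,
    h.theta_d] at h2 ⊢
  linear_combination -6 * h2 - 2 * q * d * h.theta_p - 8 * p * d * h.theta_q + 3 * d * h.theta_r

lemma theta_theta_r_mul_d (h : IsRamanujanSystem p q r d) :
    24 * (q * r * d - qTheta^[2] (r * d)) =
      19 * ((q * r + 2 * p * q ^ 2 - 3 * p ^ 2 * r) * d) := by
  have h1 : 2 * qTheta (r * d) = (3 * (p * r) - q * q) * d := by
    rw [qTheta_mul, h.theta_d]
    linear_combination d * h.theta_r
  have h2 := congrArg qTheta h1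
  simp only [qTheta_ofNat, qTheta_mul, qTheta_sub, h.theta_d] at h2
  simp only [Function.iterate_succ, Function.iterate_zero, Function.comp_apply, id, qTheta_mul,
    h.theta_d] at h2 ⊢
  linear_combination -12 * h2 - 3 * r * d * h.theta_p + 8 * q * d * h.theta_q -
    18 * p * d * h.theta_r

lemma theta_theta_q_mul_r_mul_d (h : IsRamanujanSystem p q r d) :
    72 * (q ^ 2 * r * d - qTheta^[2] (q * r * d)) =
      23 * ((q ^ 2 * r + 6 * p * q ^ 3 + 4 * p * r ^ 2 - 11 * p ^ 2 * q * r) * d) := by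
  have h1 : 6 * qTheta (q * r * d) = (11 * (p * q * r) - 2 * (r * r) - 3 * (q * q * q)) * d := by
    rw [qTheta_mul, qTheta_mul, h.theta_d]
    linear_combination 2 * r * d * h.theta_q + 3 * q * d * h.theta_r
  have h2 := congrArg qTheta h1
  simp only [qTheta_ofNat, qTheta_mul, qTheta_sub, h.theta_d] at h2
  simp only [Function.iterate_succ, Function.iterate_zero, Function.comp_apply, id, qTheta_mul,
    h.theta_d] at h2 ⊢
  linear_combination -12 * h2 - 11 * q * r * d * h.theta_p -
    (44 * p * r * d - 36 * q ^ 2 * d) * h.theta_q -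
    (66 * p * q * d - 24 * r * d) * h.theta_r

end IsRamanujanSystem

/-- Two integral power series are congruent modulo `ℓ` if a multiple of their difference, by a
factor prime to `ℓ`, is divisible by `ℓ`. -/
lemma map_zmod_eq_of_mul_sub_eq {ℓ : ℕ} [Fact ℓ.Prime] {F G : ℤ⟦X⟧} (c : ℤ)
    (hc : ¬ (ℓ : ℤ) ∣ c) (H : ℤ⟦X⟧) (h : (c : ℤ⟦X⟧) * (F - G) = ((ℓ : ℤ) : ℤ⟦X⟧) * H) :
    PowerSeries.map (Int.castRingHom (ZMod ℓ)) F =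
      PowerSeries.map (Int.castRingHom (ZMod ℓ)) G := by
  ext n
  have hn := congrArg (PowerSeries.coeff n) h
  rw [coeff_intCast_mul, coeff_intCast_mul] at hn
  have hn' := congrArg (Int.cast (R := ZMod ℓ)) hn
  rw [← ZMod.intCast_zmod_eq_zero_iff_dvd] at hc
  simpa [hc, sub_eq_zero] using hn'

end Theta

/-! ### Integral models of the Eisenstein series and of the discriminant. -/

section IntegralExpansions

open UpperHalfPlane ModularForm EisensteinSeries
open scoped ArithmeticFunction.sigma

/-- The generating series `∑ σₖ(n) qⁿ`. -/
noncomputable def sigmaSeries (k : ℕ) : ℤ⟦X⟧ := .mk fun n ↦ (σ k n : ℤ)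

/-- The series `1 + c ∑ σₖ(n) qⁿ`. -/
noncomputable def eisensteinSeriesInt (c : ℤ) (k : ℕ) : ℤ⟦X⟧ := 1 + c * sigmaSeries k

lemma coeff_map_eisensteinSeriesInt {R : Type*} [CommRing R] (c : ℤ) (k n : ℕ) :
    (PowerSeries.map (Int.castRingHom R) (eisensteinSeriesInt c k)).coeff n =
      if n = 0 then 1 else (c : R) * (σ k n : R) := by
  rcases eq_or_ne n 0 with rfl | hn
  -- Here σₖ(0) = 0, the sum over an empty set of divisors, so the constant term is 1.
  · rw [PowerSeries.coeff_map, eisensteinSeriesInt, map_add, coeff_intCast_mul]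
    simp [sigmaSeries]
  · rw [PowerSeries.coeff_map, eisensteinSeriesInt, map_add, coeff_intCast_mul]
    simp [sigmaSeries, PowerSeries.coeff_one, hn]

lemma map_E_two :
    PowerSeries.map (Int.castRingHom ℂ) (eisensteinSeriesInt (-24) 1) = qExpansion 1 E2 := by
  ext n
  rw [coeff_map_eisensteinSeriesInt, qExpansion_E2_coeff]
  norm_num

lemma map_E {k : ℕ} (hk : 3 ≤ k) (hk2 : Even k) (c : ℤ) (hc : c * bernoulli k = -(2 * k)) :
    PowerSeries.map (Int.castRingHom ℂ) (eisensteinSeriesInt c (k - 1)) =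
      qExpansion 1 (E hk) := by
  ext n
  rw [coeff_map_eisensteinSeriesInt, E_qExpansion_coeff hk hk2]
  have hb : (bernoulli k : ℂ) ≠ 0 := by
    intro h
    rw [Rat.cast_eq_zero.mp h, mul_zero] at hc
    have : (k : ℚ) = 0 := by linarith
    have : k = 0 := by exact_mod_cast this
    lia
  have hc' : (c : ℂ) * (bernoulli k : ℂ) = -(2 * k) := by
    exact_mod_cast congrArg (Rat.cast (K := ℂ)) hc
  split_ifs
  · rfl
  · rw [← neg_div, ← hc', mul_div_cancel_right₀ _ hb]

lemma map_E_four :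
    PowerSeries.map (Int.castRingHom ℂ) (eisensteinSeriesInt 240 3) = qExpansion 1 E₄ :=
  map_E _ ⟨2, rfl⟩ 240 (by norm_num [show bernoulli 4 = -1 / 30 by decide +kernel])

lemma map_E_six :
    PowerSeries.map (Int.castRingHom ℂ) (eisensteinSeriesInt (-504) 5) = qExpansion 1 E₆ :=
  map_E _ ⟨3, rfl⟩ (-504) (by norm_num [show bernoulli 6 = 1 / 42 by decide +kernel])

lemma map_intCast_injective :
    Function.Injective (PowerSeries.map (Int.castRingHom ℂ)) :=
  PowerSeries.map_injective _ Int.cast_injective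

lemma eisensteinSeriesInt_ten :
    eisensteinSeriesInt 240 3 * eisensteinSeriesInt (-504) 5 = eisensteinSeriesInt (-264) 9 := by
  apply map_intCast_injective
  rw [map_mul, map_E_four, map_E_six, qExpansion_E_ten]
  exact (map_E _ ⟨5, rfl⟩ (-264)
    (by norm_num [show bernoulli 10 = 5 / 66 by decide +kernel])).symm

lemma eisensteinSeriesInt_fourteen :
    eisensteinSeriesInt 240 3 ^ 2 * eisensteinSeriesInt (-504) 5 =
      eisensteinSeriesInt (-24) 13 := by
  apply map_intCast_injective
  rw [map_mul, map_pow, map_E_four, map_E_six, qExpansion_E_fourteen]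
  exact (map_E _ ⟨7, rfl⟩ (-24)
    (by norm_num [show bernoulli 14 = 7 / 6 by decide +kernel])).symm

/-- Already 5d³ + 7d⁵ ≡ 0 mod 12 for each divisor d, by checking residues. This supplies the
integrality of Δ. -/
lemma twelve_dvd_five_sigma_add_seven_sigma (n : ℕ) :
    (12 : ℤ) ∣ 5 * (σ 3 n : ℤ) + 7 * (σ 5 n : ℤ) := by
  simp only [ArithmeticFunction.sigma_apply, Nat.cast_sum, Finset.mul_sum, Nat.cast_pow,
    ← Finset.sum_add_distrib]
  refine Finset.dvd_sum fun d _ ↦ ?_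
  rw [show (12 : ℤ) = (12 : ℕ) from rfl, ← ZMod.intCast_zmod_eq_zero_iff_dvd]
  push_cast
  generalize (d : ZMod 12) = x
  revert x
  decide

lemma exists_discriminantInt : ∃ D : ℤ⟦X⟧,
    1728 * D = eisensteinSeriesInt 240 3 ^ 3 - eisensteinSeriesInt (-504) 5 ^ 2 := by
  choose c hc using twelve_dvd_five_sigma_add_seven_sigma
  have h : 12 * PowerSeries.mk c = 5 * sigmaSeries 3 + 7 * sigmaSeries 5 := by
    ext n
    rw [map_add, ← Int.cast_ofNat, ← Int.cast_ofNat (n := 5), ← Int.cast_ofNat (n := 7),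
      coeff_intCast_mul, coeff_intCast_mul, coeff_intCast_mul]
    simpa [sigmaSeries] using (hc n).symm
  -- In the expansion of Q³ − R² the nonlinear coefficients 3·240², 240³, 504² are 1728 times 100,
  -- 8000, 147; the linear part is 144(5∑σ₃(n)qⁿ + 7∑σ₅(n)qⁿ).
  refine ⟨.mk c + 100 * sigmaSeries 3 ^ 2 + 8000 * sigmaSeries 3 ^ 3 - 147 * sigmaSeries 5 ^ 2, ?_⟩
  simp only [eisensteinSeriesInt, Int.cast_neg, Int.cast_ofNat]
  linear_combination 144 * h

/-- The `q`-expansion of the discriminant, with integer coefficients. -/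
noncomputable def discriminantInt : ℤ⟦X⟧ := exists_discriminantInt.choose

lemma discriminantInt_spec :
    1728 * discriminantInt = eisensteinSeriesInt 240 3 ^ 3 - eisensteinSeriesInt (-504) 5 ^ 2 :=
  exists_discriminantInt.choose_spec

lemma map_discriminantInt :
    PowerSeries.map (Int.castRingHom ℂ) discriminantInt = qExpansion 1 discriminant := by
  have h := congrArg (PowerSeries.map (Int.castRingHom ℂ)) discriminantInt_spec
  simp only [map_mul, map_sub, map_pow, map_ofNat, map_E_four, map_E_six] at h
  rw [← qExpansion_discriminant] at h
  exact mul_left_cancel₀ (powerSeries_ofNat_ne_zero 1728) h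

lemma isRamanujanSystem_int : IsRamanujanSystem (eisensteinSeriesInt (-24) 1)
    (eisensteinSeriesInt 240 3) (eisensteinSeriesInt (-504) 5) discriminantInt := by
  have hp : 12 * qTheta (eisensteinSeriesInt (-24) 1) =
      eisensteinSeriesInt (-24) 1 ^ 2 - eisensteinSeriesInt 240 3 := by
    apply map_intCast_injective
    simp only [map_mul, map_sub, map_pow, map_ofNat, map_qTheta, map_E_two, map_E_four]
    exact qTheta_E_two
  have hq : 3 * qTheta (eisensteinSeriesInt 240 3) =
      eisensteinSeriesInt (-24) 1 * eisensteinSeriesInt 240 3 - eisensteinSeriesInt (-504) 5 := by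
    apply map_intCast_injective
    simp only [map_mul, map_sub, map_ofNat, map_qTheta, map_E_two, map_E_four, map_E_six]
    exact qTheta_E_four
  have hr : 2 * qTheta (eisensteinSeriesInt (-504) 5) =
      eisensteinSeriesInt (-24) 1 * eisensteinSeriesInt (-504) 5 -
        eisensteinSeriesInt 240 3 ^ 2 := by
    apply map_intCast_injective
    simp only [map_mul, map_sub, map_pow, map_ofNat, map_qTheta, map_E_two, map_E_four, map_E_six]
    exact qTheta_E_six
  refine ⟨hp, hq, hr, ?_⟩
  -- θ(Q³ − R²) = Q²(PQ − R) − R(PR − Q²) = P(Q³ − R²).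
  have h := congrArg qTheta discriminantInt_spec
  simp only [pow_succ, pow_zero, one_mul, qTheta_ofNat, qTheta_sub, qTheta_mul] at h
  refine mul_left_cancel₀ (a := (1728 : ℤ⟦X⟧)) (powerSeries_ofNat_ne_zero 1728) ?_
  rw [zero_mul, zero_add] at h
  linear_combination h + eisensteinSeriesInt 240 3 ^ 2 * hq - eisensteinSeriesInt (-504) 5 * hr -
    eisensteinSeriesInt (-24) 1 * discriminantInt_spec

/-- Fermat's little theorem: `E₁₄ ≡ E₂` modulo `13`. -/
lemma map_zmod_eisensteinSeriesInt_thirteen :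
    PowerSeries.map (Int.castRingHom (ZMod 13)) (eisensteinSeriesInt (-24) 13) =
      PowerSeries.map (Int.castRingHom (ZMod 13)) (eisensteinSeriesInt (-24) 1) := by
  have : Fact (Nat.Prime 13) := ⟨by norm_num⟩
  ext n
  simp only [coeff_map_eisensteinSeriesInt, ArithmeticFunction.sigma_apply, Nat.cast_sum,
    Nat.cast_pow, ZMod.pow_card, pow_one]

/-- `E₁₀ ≡ 1` modulo `11`. -/
lemma map_zmod_eisensteinSeriesInt_eleven :
    PowerSeries.map (Int.castRingHom (ZMod 11)) (eisensteinSeriesInt (-264) 9) = 1 := by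
  ext n
  rw [coeff_map_eisensteinSeriesInt, show ((-264 : ℤ) : ZMod 11) = 0 by decide, zero_mul,
    PowerSeries.coeff_one]

end IntegralExpansions

/-! ### Integral expansions of the six cusp forms, and the congruences. -/

section Congruences

open UpperHalfPlane ModularForm EisensteinSeries

lemma cuspForm_level_one {k l : ℤ} (hl : k + 12 = l) (hk : k < 12 ∨ k = 14)
    (H : ModularForm 𝒮ℒ k) {M : ℤ⟦X⟧} (hM : M.coeff 0 = 1)
    (hH : qExpansion 1 H = PowerSeries.map (Int.castRingHom ℂ) M) :
    (∃! f : CuspForm 𝒮ℒ l, IsNormalizedCuspForm f) ∧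
      ∀ f : CuspForm 𝒮ℒ l, IsNormalizedCuspForm f →
        IsIntegralQExpansion f (M * discriminantInt) := by
  obtain ⟨h1, h2⟩ := existsUnique_isNormalizedCuspForm hl hk H (by
    rw [hH, PowerSeries.coeff_map, hM, map_one])
  refine ⟨h1, fun f hf ↦ ?_⟩
  rw [IsIntegralQExpansion, map_mul, map_discriminantInt, h2 f hf, hH, mul_comm]

lemma constantCoeff_eisensteinSeriesInt (c : ℤ) {k : ℕ} :
    PowerSeries.constantCoeff (eisensteinSeriesInt c k) = 1 := by
  simp [eisensteinSeriesInt, sigmaSeries]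

lemma cuspForm_weight_twelve : (∃! f : CuspForm 𝒮ℒ 12, IsNormalizedCuspForm f) ∧
    ∀ f : CuspForm 𝒮ℒ 12, IsNormalizedCuspForm f → IsIntegralQExpansion f discriminantInt := by
  have h := cuspForm_level_one (k := 0) (l := 12) (by norm_num) (.inl (by norm_num)) 1 (M := 1)
    (by simp) (by rw [map_one, ModularForm.qExpansion_one])
  rwa [one_mul] at h

lemma cuspForm_weight_sixteen : (∃! f : CuspForm 𝒮ℒ 16, IsNormalizedCuspForm f) ∧
    ∀ f : CuspForm 𝒮ℒ 16, IsNormalizedCuspForm f →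
      IsIntegralQExpansion f (eisensteinSeriesInt 240 3 * discriminantInt) :=
  cuspForm_level_one (k := 4) (by norm_num) (.inl (by norm_num)) E₄
    (by simp [constantCoeff_eisensteinSeriesInt]) map_E_four.symm

lemma cuspForm_weight_eighteen : (∃! f : CuspForm 𝒮ℒ 18, IsNormalizedCuspForm f) ∧
    ∀ f : CuspForm 𝒮ℒ 18, IsNormalizedCuspForm f →
      IsIntegralQExpansion f (eisensteinSeriesInt (-504) 5 * discriminantInt) :=
  cuspForm_level_one (k := 6) (by norm_num) (.inl (by norm_num)) E₆
    (by simp [constantCoeff_eisensteinSeriesInt]) map_E_six.symm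

lemma cuspForm_weight_twenty : (∃! f : CuspForm 𝒮ℒ 20, IsNormalizedCuspForm f) ∧
    ∀ f : CuspForm 𝒮ℒ 20, IsNormalizedCuspForm f →
      IsIntegralQExpansion f (eisensteinSeriesInt 240 3 ^ 2 * discriminantInt) :=
  cuspForm_level_one (k := 4 + 4) (by norm_num) (.inl (by norm_num)) (E₄.mul E₄)
    (by simp [constantCoeff_eisensteinSeriesInt])
    (by rw [ModularForm.qExpansion_mul one_pos one_mem_strictPeriods_SL, map_pow, map_E_four, sq])

lemma cuspForm_weight_twentyTwo : (∃! f : CuspForm 𝒮ℒ 22, IsNormalizedCuspForm f) ∧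
    ∀ f : CuspForm 𝒮ℒ 22, IsNormalizedCuspForm f →
      IsIntegralQExpansion f
        (eisensteinSeriesInt 240 3 * eisensteinSeriesInt (-504) 5 * discriminantInt) :=
  cuspForm_level_one (k := 4 + 6) (by norm_num) (.inl (by norm_num)) (E₄.mul E₆)
    (by simp [constantCoeff_eisensteinSeriesInt])
    (by rw [ModularForm.qExpansion_mul one_pos one_mem_strictPeriods_SL, map_mul, map_E_four,
      map_E_six])

lemma cuspForm_weight_twentySix : (∃! f : CuspForm 𝒮ℒ 26, IsNormalizedCuspForm f) ∧
    ∀ f : CuspForm 𝒮ℒ 26, IsNormalizedCuspForm f →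
      IsIntegralQExpansion f
        (eisensteinSeriesInt 240 3 ^ 2 * eisensteinSeriesInt (-504) 5 * discriminantInt) :=
  cuspForm_level_one (k := 4 + 4 + 6) (by norm_num) (.inr (by norm_num)) ((E₄.mul E₄).mul E₆)
    (by simp [constantCoeff_eisensteinSeriesInt])
    (by rw [ModularForm.qExpansion_mul one_pos one_mem_strictPeriods_SL,
      ModularForm.qExpansion_mul one_pos one_mem_strictPeriods_SL, map_mul, map_pow, map_E_four,
      map_E_six, sq])

/-- Reduction commutes with θ, so θ may be applied over ℤ, where the Ramanujan identities hold. -/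
lemma CongrTheta.of_map_eq {ℓ i : ℕ} {k k' : ℤ} {f : CuspForm 𝒮ℒ k} {g : CuspForm 𝒮ℒ k'}
    {F G : ℤ⟦X⟧} (hF : IsIntegralQExpansion f F) (hG : IsIntegralQExpansion g G)
    (h : PowerSeries.map (Int.castRingHom (ZMod ℓ)) F =
      PowerSeries.map (Int.castRingHom (ZMod ℓ)) (qTheta^[i] G)) : CongrTheta ℓ i f g :=
  ⟨F, G, hF, hG, h.trans (map_qTheta_iterate _ i G)⟩

end Congruences

theorem proposition4p1 :
    (∀ k : ℕ, k ∈ ({12, 16, 18, 20, 22, 26} : Set ℕ) →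
      ∃! f : CuspForm 𝒮ℒ (k : ℤ), IsNormalizedCuspForm f) ∧
    (∀ k ℓ i k' : ℕ,
      (k, ℓ, i, k') ∈ ({(16, 13, 2, 12), (20, 17, 2, 16), (22, 11, 0, 12),
        (22, 19, 2, 18), (26, 13, 1, 12), (26, 23, 2, 22)} : Set (ℕ × ℕ × ℕ × ℕ)) →
      ∀ (f : CuspForm 𝒮ℒ (k : ℤ)) (g : CuspForm 𝒮ℒ (k' : ℤ)),
        IsNormalizedCuspForm f → IsNormalizedCuspForm g → CongrTheta ℓ i f g) := by
  refine ⟨fun k hk ↦ ?_, fun k ℓ i k' h f g hf hg ↦ ?_⟩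
  · rcases hk with rfl | rfl | rfl | rfl | rfl | rfl
    · exact cuspForm_weight_twelve.1
    · exact cuspForm_weight_sixteen.1
    · exact cuspForm_weight_eighteen.1
    · exact cuspForm_weight_twenty.1
    · exact cuspForm_weight_twentyTwo.1
    · exact cuspForm_weight_twentySix.1
  · simp only [Set.mem_insert_iff, Set.mem_singleton_iff, Prod.mk.injEq] at h
    rcases h with ⟨rfl, rfl, rfl, rfl⟩ | ⟨rfl, rfl, rfl, rfl⟩ | ⟨rfl, rfl, rfl, rfl⟩ |
      ⟨rfl, rfl, rfl, rfl⟩ | ⟨rfl, rfl, rfl, rfl⟩ | ⟨rfl, rfl, rfl, rfl⟩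
    · have : Fact (Nat.Prime 13) := ⟨by norm_num⟩
      refine .of_map_eq (cuspForm_weight_sixteen.2 f hf) (cuspForm_weight_twelve.2 g hg) ?_
      -- The factor 12 clears the denominators in Ramanujan's equations; 18, 24 and 72 do so below.
      exact map_zmod_eq_of_mul_sub_eq 12 (by norm_num) _
        (by exact_mod_cast isRamanujanSystem_int.theta_theta_d)
    · have : Fact (Nat.Prime 17) := ⟨by norm_num⟩
      refine .of_map_eq (cuspForm_weight_twenty.2 f hf) (cuspForm_weight_sixteen.2 g hg) ?_
      exact map_zmod_eq_of_mul_sub_eq 18 (by norm_num) _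
        (by exact_mod_cast isRamanujanSystem_int.theta_theta_q_mul_d)
    · refine .of_map_eq (cuspForm_weight_twentyTwo.2 f hf) (cuspForm_weight_twelve.2 g hg) ?_
      rw [eisensteinSeriesInt_ten, map_mul, map_zmod_eisensteinSeriesInt_eleven, one_mul,
        Function.iterate_zero, id]
    · have : Fact (Nat.Prime 19) := ⟨by norm_num⟩
      refine .of_map_eq (cuspForm_weight_twentyTwo.2 f hf) (cuspForm_weight_eighteen.2 g hg) ?_
      exact map_zmod_eq_of_mul_sub_eq 24 (by norm_num) _
        (by exact_mod_cast isRamanujanSystem_int.theta_theta_r_mul_d)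
    · refine .of_map_eq (cuspForm_weight_twentySix.2 f hf) (cuspForm_weight_twelve.2 g hg) ?_
      rw [eisensteinSeriesInt_fourteen, map_mul, map_zmod_eisensteinSeriesInt_thirteen, ← map_mul,
        Function.iterate_one, isRamanujanSystem_int.theta_d]
    · have : Fact (Nat.Prime 23) := ⟨by norm_num⟩
      refine .of_map_eq (cuspForm_weight_twentySix.2 f hf) (cuspForm_weight_twentyTwo.2 g hg) ?_
      exact map_zmod_eq_of_mul_sub_eq 72 (by norm_num) _
        (by exact_mod_cast isRamanujanSystem_int.theta_theta_q_mul_r_mul_d)
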